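/- The almost Golomb sequence of order $4$ is the sequence $(a(n))_{n\in\mathbb Z}$ with $a(k)=0$ for $k\le 0$, whose terms $a(1)\le a(2)\le a(3)\le\cdots$ are positive integers satisfying $$a\bigl(a(n)+a(n-1)+a(n-2)+a(n-3)\bigr)=n\qquad(n\ge 1),$$ and which is greedy: for every $n\ge1$, $a(n)$ is the smallest value at $n$ among all sequences with these properties that agree with $a$ at all indices less than $n$. (It begins $1,2,2,2,3,3,4,4,5,6,6,7,\ldots$) A sequence $(f(n))_{n\ge0}$ of integers is $4$-automatic if it takes finitely many values and its $4$-kernel $\{(f(4^i n+j))_{n\ge0}: i\ge0,\ 0\le j<4^i\}$ is finite; it is $4$-regular if the $\mathbb Z$-module spanned by its $4$-kernel is finitely generated. **Theorem.** There is exactly one almost Golomb sequence $a$ of order $4$. There are integer sequences $\varepsilon_0,\varepsilon_1,\varepsilon_2,\varepsilon_3$ on $\{0,1,2,\ldots\}$, each of them $4$-automatic, such that for all $n\ge5$ one has $\varepsilon_i(n)\in\{0,1\}$ $(i=0,1,2,3)$ and $$\begin{aligned} a(4n)&=a(n-3)+a(n-2)+a(n-1)+a(n)+1+\varepsilon_0(n),\\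 a(4n+1)&=a(n-2)+a(n-1)+a(n)+a(n+1)+\varepsilon_1(n),\\ a(4n+2)&=a(n-2)+a(n-1)+a(n)+a(n+1)+\varepsilon_2(n),\\ a(4n+3)&=a(n-1)+a(n)+a(n+1)+a(n+2)-1+\varepsilon_3(n). \end{aligned}$$ Their values for $n=5,6,\ldots,23$ are $$\begin{array}{c|ccccccccccccccccccc} n&5&6&7&8&9&10&11&12&13&14&15&16&17&18&19&20&21&22&23\\\hline \varepsilon_0(n)&0&1&1&1&1&1&1&1&1&1&1&1&0&1&0&1&1&0&1\\ \varepsilon_1(n)&1&0&0&0&0&0&0&0&0&0&0&0&1&0&1&0&0&1&0\\ \varepsilon_2(n)&1&1&1&1&1&1&1&1&1&1&1&0&1&0&1&1&0&1&0\\ \varepsilon_3(n)&0&0&0&0&0&0&0&0&0&0&0&1&0&1&0&0&1&0&1 \end{array}$$ and for every integer $m\ge6$, with $x\oplus y:=x+y-2xy$ and $(x\equiv y):=1-x-y+2xy$, $$\begin{aligned} \varepsilon_0(4m)&=(1-\varepsilon_0(m))\varepsilon_0(m+1)+\varepsilon_0(m)\varepsilon_0(m-1),\\ \varepsilon_0(4m+1)&=(1-\varepsilon_0(m))\varepsilon_0(m-1)+\varepsilon_0(m)\varepsilon_0(m+1),\\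 \varepsilon_0(4m+2)&=\varepsilon_0(m),\qquad \varepsilon_0(4m+3)=\varepsilon_0(m+1),\\ \varepsilon_1(4m)&=\varepsilon_2(m)\,\bigl(\varepsilon_1(m-1)\oplus\varepsilon_1(m+1)\bigr),\\ \varepsilon_1(4m+1)&=1-\varepsilon_2(m),\qquad \varepsilon_1(4m+2)=\varepsilon_1(m),\qquad \varepsilon_1(4m+3)=\varepsilon_1(m+1),\\ \varepsilon_2(4m)&=(1-\varepsilon_0(m-1))\varepsilon_1(m-1)+\varepsilon_0(m-1)(1-\varepsilon_1(m-1))\varepsilon_2(m),\\ \varepsilon_2(4m+1)&=\varepsilon_2(m-1),\qquad \varepsilon_2(4m+2)=\varepsilon_2(m),\qquad \varepsilon_2(4m+3)=1-\varepsilon_1(m),\\ \varepsilon_3(4m)&=\varepsilon_2(m-1)\,\bigl(\varepsilon_2(m)\equiv\varepsilon_1(m)\bigr),\\ \varepsilon_3(4m+1)&=\varepsilon_3(m-1),\qquad \varepsilon_3(4m+2)=\varepsilon_3(m),\\ \varepsilon_3(4m+3)&=(1-\varepsilon_1(m+1))\,\bigl(\varepsilon_2(m)\equiv\varepsilon_1(m)\bigr).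 \end{aligned}$$ Moreover the sequence $(a(n))_{n\ge0}$ is $4$-regular. -/

import Mathlib

/-- The window sum `a(n) + a(n-1) + ⋯ + a(n-r+1)`. -/
def windowSum (r : ℕ) (a : ℤ → ℤ) (n : ℤ) : ℤ :=
  ∑ j ∈ Finset.range r, a (n - (j : ℤ))

/-- `a` restricted to `n ≥ 1` is a nondecreasing sequence of positive integers, it is extended by
`a(k) = 0` for `k ≤ 0`, and it satisfies `a(a(n) + a(n-1) + ⋯ + a(n-r+1)) = n` for all `n ≥ 1`. -/
structure SolvesWindowEquation (r : ℕ) (a : ℤ → ℤ) : Prop where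
  eq_zero : ∀ k : ℤ, k ≤ 0 → a k = 0
  pos : ∀ n : ℤ, 1 ≤ n → 0 < a n
  mono : ∀ m n : ℤ, 1 ≤ m → m ≤ n → a m ≤ a n
  eqn : ∀ n : ℤ, 1 ≤ n → a (windowSum r a n) = n

/-- `a` is the almost Golomb sequence of order `r`: it solves the window equation, and it is greedy,
i.e. each term `a(n)` is the smallest value that any solution with the same earlier terms
`a(1), …, a(n-1)` can take at `n`. -/
structure IsAlmostGolomb (r : ℕ) (a : ℤ → ℤ) : Prop where
  solves : SolvesWindowEquation r a
  greedy : ∀ b : ℤ → ℤ, SolvesWindowEquation r b →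
    ∀ n : ℤ, 1 ≤ n → (∀ k : ℤ, k < n → b k = a k) → a n ≤ b n

/-- The `k`-kernel of a sequence `f`: the set of all the sequences `n ↦ f (k ^ i * n + j)` with
`i ≥ 0` and `0 ≤ j < k ^ i`. -/
def seqKernel (k : ℕ) (f : ℕ → ℤ) : Set (ℕ → ℤ) :=
  {g | ∃ i j : ℕ, j < k ^ i ∧ g = fun n => f (k ^ i * n + j)}

/-- `f` is `k`-automatic: it takes values in a finite set and its `k`-kernel is finite. -/
def IsAutomaticSeq (k : ℕ) (f : ℕ → ℤ) : Prop :=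
  (Set.range f).Finite ∧ (seqKernel k f).Finite

/-- `f` is `k`-regular: the `ℤ`-module spanned by its `k`-kernel is finitely generated. -/
def IsRegularSeq (k : ℕ) (f : ℕ → ℤ) : Prop :=
  (Submodule.span ℤ (seqKernel k f)).FG

/-- XOR of bits, as an integer polynomial. -/
def bitXor (x y : ℤ) : ℤ := x + y - 2 * x * y

/-- XNOR of bits, as an integer polynomial. -/
def bitXnor (x y : ℤ) : ℤ := 1 - x - y + 2 * x * y

/-- The values `f(5), f(6), …, f(23)`. -/
def initialValues (f : ℕ → ℤ) : List ℤ := (List.range' 5 19).map f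

/-! The correction bits and a candidate `golomb` are defined by the stated recurrences from initial
values; what must be proved is that this candidate is the almost Golomb sequence.

The argument is a finite substitution check. Record at each index the increment of `golomb` and the
four bits. Ten consecutive letters from `p` on determine the windows near `4p` (`window_refine`), as
well as `golomb` near `4p` relative to `4 * golomb p` (`golomb_refine`). Write `w(n)` for the window
sum at `n`. The window around `n` determines `w(4n+i) - 4w(n)`, and with the window around `w(n)` it
determines `a(w(4n+i)) - 4a(w(n))`. A finite list of window pairs is closed under passing from `n`
to `4n+i`, and on it the second difference is always `i`; so `a(w(n)) = n` follows by induction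
(`exists_windowPair`).

The same list shows that increments are 0 or 1 and that `a` jumps at `w(n)`, so `w(n)` is the first
index with value `n`. Greediness follows: for `n ≥ 3` and `m = a(n) < n`, one has `w(m) ≤ n`, and a
solution `b` with the same earlier terms has the same `w(m)`, whence `b(n) ≥ b(w(m)) = m`. Finally,
the windows are the states of a finite base 4 automaton, which gives automaticity and regularity. -/

/-! ### Correction bits -/

/-- The four correction bits at a given index. -/
structure Correctors where
  e0 : Bool
  e1 : Bool
  e2 : Bool
  e3 : Bool
deriving DecidableEq, Inhabited

/-- The correction bits at `4 * m + r` in terms of those at `m - 1`, `m`, `m + 1`. -/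
def correctorRule (x y z : Correctors) : ℕ → Correctors
  | 0 => ⟨cond y.e0 x.e0 z.e0, y.e2 && (x.e1 ^^ z.e1), cond x.e0 (!x.e1 && y.e2) x.e1,
      x.e2 && !(y.e2 ^^ y.e1)⟩
  | 1 => ⟨cond y.e0 z.e0 x.e0, !y.e2, x.e2, x.e3⟩
  | 2 => y
  | _ => ⟨z.e0, z.e1, !y.e1, !z.e1 && !(y.e2 ^^ y.e1)⟩

/-- The correction bits at the indices below `24`. -/
def initialCorrectors (n : ℕ) : Correctors where
  e0 := [0, 0, 0, 0, 0, 0, 1, 1, 1, 1, 1, 1, 1, 1, 1, 1, 1, 0, 1, 0, 1, 1, 0, 1].getD n 0 == 1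
  e1 := [0, 0, 0, 0, 0, 1, 0, 0, 0, 0, 0, 0, 0, 0, 0, 0, 0, 1, 0, 1, 0, 0, 1, 0].getD n 0 == 1
  e2 := [0, 0, 0, 0, 0, 1, 1, 1, 1, 1, 1, 1, 1, 1, 1, 1, 0, 1, 0, 1, 1, 0, 1, 0].getD n 0 == 1
  e3 := [0, 0, 0, 0, 0, 0, 0, 0, 0, 0, 0, 0, 0, 0, 0, 0, 1, 0, 1, 0, 0, 1, 0, 1].getD n 0 == 1

/-- The correction bits, computed with bounded recursion depth. -/
def correctorsFuel : ℕ → ℕ → Correctors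
  | 0, n => initialCorrectors n
  | f + 1, n =>
    if n < 24 then initialCorrectors n
    else correctorRule (correctorsFuel f (n / 4 - 1)) (correctorsFuel f (n / 4))
      (correctorsFuel f (n / 4 + 1)) (n % 4)

/-- The correction bits at `n`. -/
def correctors (n : ℕ) : Correctors := correctorsFuel n n

/-- For `n ≥ 24` the recursion only calls indices up to `n / 4 + 1 < n`, so depth `n` suffices. -/
theorem correctorsFuel_eq (f g n : ℕ) (hf : n ≤ f) (hg : n ≤ g) :
    correctorsFuel f n = correctorsFuel g n := by
  induction f generalizing g n with
  | zero =>
    obtain rfl : n = 0 := by omega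
    cases g <;> simp [correctorsFuel]
  | succ f ih =>
    cases g with
    | zero =>
      obtain rfl : n = 0 := by omega
      simp [correctorsFuel]
    | succ g =>
      by_cases h : n < 24
      · simp [correctorsFuel, h]
      · simp only [correctorsFuel, h, if_false]
        rw [ih g (n / 4 - 1) (by omega) (by omega), ih g (n / 4) (by omega) (by omega),
          ih g (n / 4 + 1) (by omega) (by omega)]

theorem correctors_step (m r : ℕ) (hm : 6 ≤ m) (hr : r < 4) :
    correctors (4 * m + r) =
      correctorRule (correctors (m - 1)) (correctors m) (correctors (m + 1)) r := by
  obtain ⟨f, hf⟩ : ∃ f, 4 * m + r = f + 1 := ⟨4 * m + r - 1, by omega⟩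
  have h : ¬ 4 * m + r < 24 := by omega
  have hd : (4 * m + r) / 4 = m := by omega
  have hmod : (4 * m + r) % 4 = r := by omega
  rw [correctors, correctorsFuel_eq _ (f + 1) _ le_rfl (by omega)]
  simp only [correctorsFuel, h, if_false, hd, hmod]
  rw [correctorsFuel_eq f (m - 1) (m - 1) (by omega) le_rfl,
    correctorsFuel_eq f m m (by omega) le_rfl,
    correctorsFuel_eq f (m + 1) (m + 1) (by omega) le_rfl]
  rfl

/-! ### The candidate sequence -/

/-- The denesting formula for the value at `4 * m + r`. -/
def denest (a : ℕ → ℤ) (e : ℕ → Correctors) (m : ℕ) : ℕ → ℤ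
  | 0 => a (m - 3) + a (m - 2) + a (m - 1) + a m + 1 + (e m).e0.toInt
  | 1 => a (m - 2) + a (m - 1) + a m + a (m + 1) + (e m).e1.toInt
  | 2 => a (m - 2) + a (m - 1) + a m + a (m + 1) + (e m).e2.toInt
  | _ => a (m - 1) + a m + a (m + 1) + a (m + 2) - 1 + (e m).e3.toInt

/-- The values of the almost Golomb sequence of order `4` at the indices below `20`. -/
def initialGolomb (n : ℕ) : ℤ :=
  [0, 1, 2, 2, 2, 3, 3, 4, 4, 5, 6, 6, 7, 7, 8, 8, 9, 9, 9, 10].getD n 0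

/-- The almost Golomb sequence of order `4`, computed with bounded recursion depth. -/
def golombFuel : ℕ → ℕ → ℤ
  | 0, n => initialGolomb n
  | f + 1, n =>
    if n < 20 then initialGolomb n else denest (golombFuel f) correctors (n / 4) (n % 4)

/-- The almost Golomb sequence of order `4` on the natural numbers. -/
def golomb (n : ℕ) : ℤ := golombFuel n n

theorem golombFuel_eq (f g n : ℕ) (hf : n ≤ f) (hg : n ≤ g) :
    golombFuel f n = golombFuel g n := by
  induction f generalizing g n with
  | zero =>
    obtain rfl : n = 0 := by omega
    cases g <;> simp [golombFuel]
  | succ f ih =>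
    cases g with
    | zero =>
      obtain rfl : n = 0 := by omega
      simp [golombFuel]
    | succ g =>
      by_cases h : n < 20
      · simp [golombFuel, h]
      · simp only [golombFuel, h, if_false]
        have key : ∀ k ≤ n / 4 + 2, golombFuel f k = golombFuel g k :=
          fun k hk => ih g k (by omega) (by omega)
        have hr : n % 4 < 4 := Nat.mod_lt _ (by norm_num)
        generalize n % 4 = r at hr
        interval_cases r <;> simp only [denest] <;>
          rw [key _ (by omega), key _ (by omega), key _ (by omega), key _ (by omega)]

theorem golomb_step (m r : ℕ) (hm : 5 ≤ m) (hr : r < 4) :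
    golomb (4 * m + r) = denest golomb correctors m r := by
  obtain ⟨f, hf⟩ : ∃ f, 4 * m + r = f + 1 := ⟨4 * m + r - 1, by omega⟩
  have h : ¬ 4 * m + r < 20 := by omega
  have hd : (4 * m + r) / 4 = m := by omega
  have hmod : (4 * m + r) % 4 = r := by omega
  rw [golomb, golombFuel_eq _ (f + 1) _ le_rfl (by omega)]
  simp only [golombFuel, h, if_false, hd, hmod]
  have key : ∀ k ≤ m + 2, golombFuel f k = golomb k :=
    fun k hk => golombFuel_eq f k k (by omega) le_rfl
  interval_cases r <;> simp only [denest] <;>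
    rw [key _ (by omega), key _ (by omega), key _ (by omega), key _ (by omega)]

/-! ### Windows and their refinement -/

/-- The increment of the sequence and the correction bits at an index. -/
structure Letter where
  d : ℤ
  c : Correctors
deriving DecidableEq, Inhabited

/-- The letter at index `n`. -/
def letterAt (n : ℕ) : Letter := ⟨golomb (n + 1) - golomb n, correctors n⟩

/-- The letters at the ten indices `p, p + 1, …, p + 9`. -/
def window (p : ℕ) : List Letter := (List.range 10).map fun u => letterAt (p + u)

/-- The sum of the first `j` increments of a window. -/
def partialSum (s : List Letter) : ℕ → ℤ
  | 0 => 0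
  | j + 1 => partialSum s j + (s.getD j default).d

/-- `golomb (4 * p + v) - 4 * golomb p` in terms of the window at `p`. -/
def refinedSum (s : List Letter) (v : ℕ) : ℤ :=
  denest (partialSum s) (fun j => (s.getD j default).c) (v / 4) (v % 4)

/-- The letter at `4 * m + r` in terms of those at `m - 3, …, m + 1`. -/
def letterRule (x : ℕ → Letter) (m r : ℕ) : Letter where
  d := match r with
    | 0 => (x (m - 3)).d + (x (m - 2)).d + (x (m - 1)).d + (x m).d - 1 + (x m).c.e1.toInt -
        (x m).c.e0.toInt
    | 1 => (x m).c.e2.toInt - (x m).c.e1.toInt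
    | 2 => (x (m - 2)).d + (x (m - 1)).d + (x m).d + (x (m + 1)).d - 1 + (x m).c.e3.toInt -
        (x m).c.e2.toInt
    | _ => 2 + (x (m + 1)).c.e0.toInt - (x m).c.e3.toInt -
        ((x (m - 2)).d + (x (m - 1)).d + (x m).d + (x (m + 1)).d)
  c := correctorRule (x (m - 1)).c (x m).c (x (m + 1)).c r

/-- The letter at `4 * p + v` in terms of the window at `p`. -/
def refinedLetter (s : List Letter) (v : ℕ) : Letter :=
  letterRule (fun j => s.getD j default) (v / 4) (v % 4)

/-- The window at `4 * p + 12 + r` in terms of the window at `p`. -/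
def refine (s : List Letter) (r : ℕ) : List Letter :=
  (List.range 10).map fun u => refinedLetter s (12 + r + u)

theorem window_getD (p j : ℕ) (hj : j < 10) : (window p).getD j default = letterAt (p + j) := by
  simp [window, List.getD, hj]

theorem golomb_add (p j : ℕ) (hj : j ≤ 10) :
    golomb (p + j) = golomb p + partialSum (window p) j := by
  induction j with
  | zero => simp [partialSum]
  | succ j ih =>
    have := ih (by omega)
    rw [partialSum, window_getD p j (by omega), letterAt, ← add_assoc]
    simp only
    linarith

/-- A denesting formula adds four nearby values, each of them `golomb p` plus a sum of increments in
the window; hence the factor 4. -/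
theorem golomb_refine (p v : ℕ) (hp : 2 ≤ p) (hv : 12 ≤ v) (hv' : v ≤ 36) :
    golomb (4 * p + v) = 4 * golomb p + refinedSum (window p) v := by
  obtain ⟨t, r, hr, rfl⟩ : ∃ t r, r < 4 ∧ v = 4 * t + r := ⟨v / 4, v % 4, by omega, by omega⟩
  have hd : (4 * t + r) / 4 = t := by omega
  have hmod : (4 * t + r) % 4 = r := by omega
  have e3 : p + t - 3 = p + (t - 3) := by omega
  have e2 : p + t - 2 = p + (t - 2) := by omega
  have e1 : p + t - 1 = p + (t - 1) := by omega
  rw [show 4 * p + (4 * t + r) = 4 * (p + t) + r by ring, golomb_step _ _ (by omega) hr,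
    refinedSum, hd, hmod]
  interval_cases r <;> simp only [denest] <;> rw [window_getD p t (by omega), letterAt]
  · rw [e3, e2, e1, golomb_add p (t - 3) (by omega), golomb_add p (t - 2) (by omega),
      golomb_add p (t - 1) (by omega), golomb_add p t (by omega)]
    ring
  · rw [e2, e1, add_assoc p t 1, golomb_add p (t - 2) (by omega),
      golomb_add p (t - 1) (by omega), golomb_add p t (by omega), golomb_add p (t + 1) (by omega)]
    ring
  · rw [e2, e1, add_assoc p t 1, golomb_add p (t - 2) (by omega),
      golomb_add p (t - 1) (by omega), golomb_add p t (by omega), golomb_add p (t + 1) (by omega)]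
    ring
  · rw [e1, add_assoc p t 1, add_assoc p t 2, golomb_add p (t - 1) (by omega),
      golomb_add p t (by omega), golomb_add p (t + 1) (by omega), golomb_add p (t + 2) (by omega)]
    ring

/-- Subtracting consecutive denesting formulas cancels their common terms, leaving at most four
increments and two bits. -/
theorem letterAt_step (m r : ℕ) (hm : 6 ≤ m) (hr : r < 4) :
    letterAt (4 * m + r) = letterRule letterAt m r := by
  obtain ⟨k, rfl⟩ : ∃ k, m = k + 3 := ⟨m - 3, by omega⟩
  have hc := correctors_step (k + 3) r hm hr
  have e1 : k + 3 - 1 = k + 2 := rfl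
  have e2 : k + 3 - 2 = k + 1 := rfl
  have e3 : k + 3 - 3 = k := rfl
  have e4 : k + 3 + 1 = k + 4 := rfl
  have e5 : k + 3 + 2 = k + 5 := rfl
  have g0 := golomb_step (k + 3) 0 (by omega) (by omega)
  have g1 := golomb_step (k + 3) 1 (by omega) (by omega)
  have g2 := golomb_step (k + 3) 2 (by omega) (by omega)
  have g3 := golomb_step (k + 3) 3 (by omega) (by omega)
  have g4 := golomb_step (k + 3 + 1) 0 (by omega) (by omega)
  have e6 : k + 4 - 1 = k + 3 := rfl
  have e7 : k + 4 - 2 = k + 2 := rfl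
  have e8 : k + 4 - 3 = k + 1 := rfl
  simp only [denest, e1, e2, e3, e4, e5, e6, e7, e8] at g0 g1 g2 g3 g4
  simp only [letterAt, letterRule, hc, Letter.mk.injEq, and_true]
  interval_cases r
  · simp only [add_zero, e1, e2, e3] at g0 ⊢
    rw [g0, g1]
    ring
  · change _ = (correctors (k + 3)).e2.toInt - (correctors (k + 3)).e1.toInt
    rw [g1, add_assoc, g2]
    ring
  · simp only [e1, e2, e4]
    rw [g2, add_assoc, g3]
    ring
  · simp only [e1, e2, e4]
    -- The last increment crosses into the next block of four.
    rw [g3, show 4 * (k + 3) + 3 + 1 = 4 * (k + 4) + 0 by ring, g4]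
    ring

theorem letterAt_refine (p v : ℕ) (hp : 3 ≤ p) (hv : 12 ≤ v) (hv' : v ≤ 35) :
    letterAt (4 * p + v) = refinedLetter (window p) v := by
  obtain ⟨t, r, hr, rfl⟩ : ∃ t r, r < 4 ∧ v = 4 * t + r := ⟨v / 4, v % 4, by omega, by omega⟩
  have hd : (4 * t + r) / 4 = t := by omega
  have hmod : (4 * t + r) % 4 = r := by omega
  rw [show 4 * p + (4 * t + r) = 4 * (p + t) + r by ring, letterAt_step _ _ (by omega) hr,
    refinedLetter, hd, hmod]
  simp only [letterRule]
  rw [window_getD p t (by omega), window_getD p (t - 1) (by omega),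
    window_getD p (t - 2) (by omega), window_getD p (t - 3) (by omega),
    window_getD p (t + 1) (by omega), show p + t - 1 = p + (t - 1) by omega,
    show p + t - 2 = p + (t - 2) by omega, show p + t - 3 = p + (t - 3) by omega, add_assoc p t 1]

/-- A letter at `4m + s` with `s < 4` needs only the letters at `m - 3, …, m + 1`, so ten letters
cover the offsets 12 to 35; the bound 14 is `35 - 12 - 9`. -/
theorem window_refine (p r : ℕ) (hp : 3 ≤ p) (hr : r ≤ 14) :
    window (4 * p + 12 + r) = refine (window p) r := by
  refine List.map_congr_left fun u hu => ?_
  have hu : u < 10 := List.mem_range.mp hu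
  rw [← letterAt_refine p _ hp (by omega) (by omega)]
  congr 1
  ring

/-! ### The finite check on pairs of windows -/

/-- The six letters that occur from index `5` on. -/
def alphabet : List Letter :=
  [⟨0, false, true, true, false⟩, ⟨1, true, false, true, false⟩, ⟨0, true, false, true, false⟩,
    ⟨0, true, false, false, true⟩, ⟨1, true, false, false, true⟩, ⟨0, false, false, true, true⟩]

/-- The word of length `k` over the alphabet whose octal code is `c`. -/
def decodeWord : ℕ → ℕ → List Letter
  | 0, _ => []
  | k + 1, c => alphabet.getD (c % 8) default :: decodeWord k (c / 8)

/-- The octal codes of the pairs of windows at `n - 4` and at `w(n) - 4`, where `w(n)` is the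
window sum at `n`. -/
def windowPairCodes : List (ℕ × ℕ) :=
  [(289739400, 420491914), (170435153, 67930137), (423957578, 286274080), (52994697, 170428441),
   (543495249, 170435104), (67936906, 170435208), (142709841, 287875722), (420491914, 155493002),
   (52561489, 170201738), (543441098, 289710673), (67930137, 155521673), (142708995, 287875665),
   (286274080, 155493001), (170001988, 170201738), (289685704, 289710673), (170428441, 289739401),
   (289739011, 170435153), (170435104, 170435209), (289739844, 170435210), (170435208, 170435210),
   (155522129, 170435210), (287875722, 170435210), (170202193, 170435210), (155493002, 52994698),
   (287872081, 67936906), (170201738, 420491914), (289710673, 739018777), (170431562, 548418080),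
   (155521673, 420501529), (287875665, 67930156), (170202186, 286274080), (155493001, 52987929),
   (287872081, 67936800), (170201738, 420491912), (289739401, 420501529), (170435153, 67930156),
   (289739850, 286274080), (170435209, 170428441), (289739857, 170435104), (170435210, 170435208),
   (289739857, 170435210), (170435210, 170435210), (423957585, 170435210), (52994698, 170435210),
   (543495249, 170435210), (67936906, 170435210), (739018777, 155521673), (92377347, 287875665),
   (548418080, 155493001), (68552260, 287642250), (142786760, 170173009), (420501529, 287871625),
   (52562691, 170201681), (543441248, 289710666), (67930156, 155521673), (142708997, 287875665),
   (423903432, 289710673), (52987929, 289739401), (543494403, 170435153), (67936800, 170435209),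
   (142709828, 287875722), (420491912, 155493002), (153654353, 67936800), (287642250, 420491912),
   (170173009, 739018777), (155489354, 548418080), (287871625, 548427801), (170201681, 548427820),
   (289710666, 548427820), (170431561, 548427820), (155521673, 420501548), (155522129, 170435104),
   (287875722, 170435208), (739640900, 287642250), (92455112, 170173009), (548427801, 153653897),
   (739642115, 287642193), (92455264, 170173002), (548427820, 153653897), (739642117, 287642193),
   (68553477, 287642193), (142786912, 170173002), (420501548, 287871625), (52562693, 170201681),
   (153653897, 548427801), (287642193, 548427820), (170173002, 548427820), (155489353, 548427820),
   (153653897, 548427820), (287871625, 548427820)]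

/-- The pairs of windows at `n - 4` and at `w(n) - 4`, where `w(n)` is the window sum at `n`. -/
def windowPairs : List (List Letter × List Letter) :=
  windowPairCodes.map fun c => (decodeWord 10 c.1, decodeWord 10 c.2)

/-- The difference between the window sum at `4 * n + i` and four times the window sum at `n`, in
terms of the window at `n - 4`. -/
def windowSumOffset (s : List Letter) (i : ℕ) : ℤ :=
  refinedSum s (13 + i) + refinedSum s (14 + i) + refinedSum s (15 + i) + refinedSum s (16 + i) -
    4 * (partialSum s 1 + partialSum s 2 + partialSum s 3 + partialSum s 4)

/-- This is the induction step in finite form: the shift of the second window stays within the range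
of `window_refine`, the value there advances by `i`, and the list is closed. -/
theorem windowPairs_refine : ∀ z ∈ windowPairs, ∀ i < 4,
    0 ≤ windowSumOffset z.1 i ∧ (windowSumOffset z.1 i).toNat ≤ 14 ∧
    refinedSum z.2 (16 + (windowSumOffset z.1 i).toNat) - 4 * partialSum z.2 4 = i ∧
    (refine z.1 i, refine z.2 (windowSumOffset z.1 i).toNat) ∈ windowPairs := by
  decide +kernel

/-- Position 4 of the first window is `n`, and position 3 of the second is `w(n) - 1`: the sequence
jumps on reaching `w(n)`. -/
theorem windowPairs_letters : ∀ z ∈ windowPairs,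
    ((z.1.getD 4 default).d = 0 ∨ (z.1.getD 4 default).d = 1) ∧ (z.2.getD 3 default).d = 1 := by
  decide +kernel

/-! ### The window equation by induction -/

/-- The window sum at `p + 4`. -/
def golombWindow (p : ℕ) : ℤ := golomb (p + 4) + golomb (p + 3) + golomb (p + 2) + golomb (p + 1)

theorem windowPairs_initial : ∀ p ∈ List.range' 5 27, 9 ≤ (golombWindow p).toNat ∧
    golombWindow p = ((golombWindow p).toNat - 4 + 4 : ℕ) ∧
    golomb ((golombWindow p).toNat - 4 + 4) = (p + 4 : ℕ) ∧
    (window p, window ((golombWindow p).toNat - 4)) ∈ windowPairs := by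
  decide +kernel

theorem golombWindow_refine (p i : ℕ) (hp : 2 ≤ p) (hi : i < 4) :
    golombWindow (4 * p + 12 + i) = 4 * golombWindow p + windowSumOffset (window p) i := by
  have h : ∀ k, k < 4 → golomb (4 * p + 12 + i + (k + 1)) =
      4 * golomb p + refinedSum (window p) (13 + k + i) := fun k hk => by
    rw [← golomb_refine p (13 + k + i) hp (by omega) (by omega)]
    congr 1
    ring
  rw [golombWindow, golombWindow, windowSumOffset, golomb_add p 1 (by omega),
    golomb_add p 2 (by omega), golomb_add p 3 (by omega), golomb_add p 4 (by omega),
    h 0 (by omega), h 1 (by omega), h 2 (by omega), h 3 (by omega)]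
  ring

theorem exists_windowPair (p : ℕ) (hp : 5 ≤ p) : ∃ q : ℕ, 5 ≤ q ∧
    golombWindow p = (q + 4 : ℕ) ∧ golomb (q + 4) = (p + 4 : ℕ) ∧
    (window p, window q) ∈ windowPairs := by
  induction p using Nat.strong_induction_on with
  | _ p ih =>
    -- Since `32 = 4 * 5 + 12`, every larger `p` is a refinement of some `p' ≥ 5`.
    by_cases hlt : p < 32
    · obtain ⟨h1, h2, h3, h4⟩ := windowPairs_initial p (by simp; omega)
      exact ⟨_, by omega, h2, h3, h4⟩
    · obtain ⟨p, i, hi, rfl⟩ : ∃ p' i, i < 4 ∧ p = 4 * p' + 12 + i :=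
        ⟨(p - 12) / 4, p % 4, by omega, by omega⟩
      obtain ⟨q, hq, hw, hg, hmem⟩ := ih p (by omega) (by omega)
      obtain ⟨h0, h14, hval, hnext⟩ := windowPairs_refine _ hmem i hi
      simp only at h0 h14 hval hnext
      have hoff := golombWindow_refine p i (by omega) hi
      set r := (windowSumOffset (window p) i).toNat with hr
      have hr' : windowSumOffset (window p) i = r := by omega
      refine ⟨4 * q + 12 + r, by omega, ?_, ?_, ?_⟩
      · rw [hoff, hw, hr']
        push_cast
        ring
      · rw [show 4 * q + 12 + r + 4 = 4 * q + (16 + r) by ring,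
          golomb_refine q (16 + r) (by omega) (by omega) (by omega)]
        rw [golomb_add q 4 (by omega)] at hg
        push_cast at hg ⊢
        linarith
      · rwa [window_refine p i (by omega) (by omega), window_refine q r (by omega) h14]

theorem letterAt_d (n : ℕ) : (letterAt n).d = golomb (n + 1) - golomb n := rfl

theorem golomb_succ_sub (n : ℕ) :
    golomb (n + 1) - golomb n = 0 ∨ golomb (n + 1) - golomb n = 1 := by
  by_cases hn : n < 9
  · interval_cases n <;> decide
  · obtain ⟨p, rfl⟩ : ∃ p, n = p + 4 := ⟨n - 4, by omega⟩
    obtain ⟨q, -, -, -, hmem⟩ := exists_windowPair p (by omega)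
    have := (windowPairs_letters _ hmem).1
    rwa [window_getD p 4 (by omega), letterAt_d] at this

theorem golomb_monotone : Monotone golomb :=
  monotone_nat_of_le_succ fun n => by
    have := golomb_succ_sub n
    omega

theorem one_le_golomb {n : ℕ} (hn : 1 ≤ n) : 1 ≤ golomb n :=
  (by decide : (1 : ℤ) ≤ golomb 1).trans (golomb_monotone hn)

theorem golomb_lt {n : ℕ} (hn : 3 ≤ n) : golomb n < n := by
  induction n, hn using Nat.le_induction with
  | base => decide
  | succ n _ ih =>
    have := golomb_succ_sub n
    push_cast
    omega

/-! ### Existence: the equation and greediness -/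

/-- The almost Golomb sequence of order `4`, extended by zero. -/
def almostGolomb (k : ℤ) : ℤ := golomb k.toNat

theorem almostGolomb_natCast (n : ℕ) : almostGolomb n = golomb n := rfl

theorem almostGolomb_monotone : Monotone almostGolomb :=
  fun _ _ h => golomb_monotone (Int.toNat_le_toNat h)

theorem windowSum_four (a : ℤ → ℤ) (n : ℤ) :
    windowSum 4 a n = a n + a (n - 1) + a (n - 2) + a (n - 3) := by
  simp [windowSum, Finset.sum_range_succ]

theorem windowSum_almostGolomb (p : ℕ) :
    windowSum 4 almostGolomb (p + 4 : ℕ) = golombWindow p := by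
  rw [windowSum_four, golombWindow, ← almostGolomb_natCast, ← almostGolomb_natCast,
    ← almostGolomb_natCast, ← almostGolomb_natCast]
  congr 3 <;> push_cast <;> ring_nf

theorem almostGolomb_initial : ∀ n ∈ List.range' 1 8,
    almostGolomb (windowSum 4 almostGolomb n) = n ∧
    (3 ≤ n → almostGolomb (windowSum 4 almostGolomb n - 1) = n - 1) := by
  decide +kernel

/-- The second part makes the window sum at `n` the first index with value `n`. It fails at `n = 2`,
where the window sum is 3 but the value 2 is already taken at index 2. -/
theorem almostGolomb_window (n : ℕ) (hn : 1 ≤ n) :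
    almostGolomb (windowSum 4 almostGolomb n) = n ∧
    (3 ≤ n → almostGolomb (windowSum 4 almostGolomb n - 1) = n - 1) := by
  by_cases h : n < 9
  · exact almostGolomb_initial n (by simp; omega)
  · obtain ⟨p, rfl⟩ : ∃ p, n = p + 4 := ⟨n - 4, by omega⟩
    obtain ⟨q, -, hw, hg, hmem⟩ := exists_windowPair p (by omega)
    have hd := (windowPairs_letters _ hmem).2
    rw [window_getD q 3 (by omega), letterAt_d] at hd
    rw [windowSum_almostGolomb, hw, show ((q + 4 : ℕ) : ℤ) - 1 = (q + 3 : ℕ) by push_cast; ring,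
      almostGolomb_natCast, almostGolomb_natCast]
    refine ⟨hg, fun _ => ?_⟩
    rw [← hg]
    linarith

theorem solvesWindowEquation_almostGolomb : SolvesWindowEquation 4 almostGolomb where
  eq_zero k hk := by rw [almostGolomb, Int.toNat_of_nonpos hk]; rfl
  pos n hn := by
    have := one_le_golomb (n := n.toNat) (by omega)
    rw [almostGolomb]
    omega
  mono m n _ h := almostGolomb_monotone h
  eqn n hn := by
    lift n to ℕ using by omega
    exact (almostGolomb_window n (by exact_mod_cast hn)).1

/-- Were `n` below the first index with value `m = a(n)`, monotonicity would give `a(n) ≤ m - 1`. -/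
theorem windowSum_almostGolomb_le {n : ℕ} (hn : 3 ≤ n) :
    windowSum 4 almostGolomb (almostGolomb n) ≤ n := by
  have hm : 2 ≤ almostGolomb n := almostGolomb_monotone (show (3 : ℤ) ≤ n by exact_mod_cast hn)
  obtain ⟨m, hmn⟩ : ∃ m : ℕ, (m : ℤ) = almostGolomb n := ⟨(almostGolomb n).toNat, by omega⟩
  rw [← hmn] at hm ⊢
  by_contra! hlt
  by_cases h3 : 3 ≤ m
  · have := (almostGolomb_window m (by omega)).2 h3
    have hle := almostGolomb_monotone (show (n : ℤ) ≤ windowSum 4 almostGolomb m - 1 by omega)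
    omega
  · obtain rfl : m = 2 := by omega
    have : windowSum 4 almostGolomb (2 : ℕ) = 3 := by decide +kernel
    omega

theorem windowSum_congr {r : ℕ} {a b : ℤ → ℤ} {n : ℤ} (h : ∀ k ≤ n, a k = b k) :
    windowSum r a n = windowSum r b n :=
  Finset.sum_congr rfl fun j _ => h _ (by omega)

theorem isAlmostGolomb_almostGolomb : IsAlmostGolomb 4 almostGolomb where
  solves := solvesWindowEquation_almostGolomb
  greedy b hb n hn heq := by
    lift n to ℕ using by omega
    rcases (show n = 1 ∨ n = 2 ∨ 3 ≤ n by omega) with rfl | rfl | h3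
    · exact hb.pos 1 le_rfl
    -- If `b 1 = b 2 = 1`, the window sum at 2 is 2 and the equation forces `b 2 = 2`.
    · change 2 ≤ b 2
      have h1 : b 1 = 1 := heq 1 (by norm_num)
      have hpos := hb.pos 2 (by norm_num)
      have hw := hb.eqn 2 (by norm_num)
      by_contra! hlt
      have h2 : b 2 = 1 := by omega
      rw [windowSum_four] at hw
      norm_num [h1, h2, hb.eq_zero 0 le_rfl, hb.eq_zero (-1) (by norm_num)] at hw
    · set m := almostGolomb n with hm
      have hmn : m < n := golomb_lt h3
      have hm1 : 1 ≤ m := one_le_golomb (by omega)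
      have hw : windowSum 4 b m = windowSum 4 almostGolomb m :=
        windowSum_congr fun k hk => heq k (by omega)
      have hle := windowSum_almostGolomb_le h3
      rw [← hm, ← hw] at hle
      have hbw := hb.eqn m hm1
      have hpos : 1 ≤ windowSum 4 b m := by
        by_contra! hlt
        rw [hb.eq_zero _ (by omega)] at hbw
        omega
      rw [← hbw]
      exact hb.mono _ _ hpos hle

/-! ### Uniqueness -/

theorem IsAlmostGolomb.unique {r : ℕ} {a b : ℤ → ℤ} (ha : IsAlmostGolomb r a)
    (hb : IsAlmostGolomb r b) : a = b := by
  have key : ∀ n : ℕ, ∀ k : ℤ, k ≤ n → a k = b k := by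
    intro n
    induction n with
    | zero =>
      intro k hk
      rw [ha.solves.eq_zero k (by simpa using hk), hb.solves.eq_zero k (by simpa using hk)]
    | succ n ih =>
      intro k hk
      push_cast at hk
      by_cases hlt : k ≤ n
      · exact ih k hlt
      · obtain rfl : k = n + 1 := by omega
        exact le_antisymm
          (ha.greedy b hb.solves _ (by omega) fun k hk => (ih k (by omega)).symm)
          (hb.greedy a ha.solves _ (by omega) fun k hk => ih k (by omega))
  exact funext fun k => key k.toNat k (Int.self_le_toNat k)

/-! ### Automatic and regular sequences from a finite automaton -/

/-- Split off the leading base `k` digit of `j`: the kernel sequence at `n` is one of lower depth at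
`k * n + j / k ^ e`, where `hf` and `hρ` apply. -/
theorem seqKernel_form {τ : Type*} {k : ℕ} {f : ℕ → ℤ} {ρ : ℕ → τ} {T : τ → ℕ → τ} {c : ℤ}
    {g : τ → ℕ → ℤ} (hρ : ∀ n, ∀ i < k, ρ (k * n + i) = T (ρ n) i)
    (hf : ∀ n, ∀ i < k, f (k * n + i) = c * f n + g (ρ n) i) {h : ℕ → ℤ}
    (hh : h ∈ seqKernel k f) : ∃ (c' : ℤ) (G : τ → ℤ), ∀ n, h n = c' * f n + G (ρ n) := by
  obtain ⟨e, j, hj, rfl⟩ := hh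
  induction e generalizing j with
  | zero =>
    obtain rfl : j = 0 := by simpa using hj
    exact ⟨1, 0, by simp⟩
  | succ e ih =>
    have hpos : 0 < k ^ e := Nat.pos_of_ne_zero fun h0 => by simp [pow_succ, h0] at hj
    obtain ⟨c', G, hG⟩ := ih (j % k ^ e) (Nat.mod_lt _ hpos)
    have hi : j / k ^ e < k := Nat.div_lt_of_lt_mul (by rwa [← pow_succ])
    refine ⟨c' * c, fun t => c' * g t (j / k ^ e) + G (T t (j / k ^ e)), fun n => ?_⟩
    have := hG (k * n + j / k ^ e)
    simp only at this ⊢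
    rw [hf n _ hi, hρ n _ hi] at this
    rw [show k ^ (e + 1) * n + j = k ^ e * (k * n + j / k ^ e) + j % k ^ e by
      conv_lhs => rw [← Nat.div_add_mod j (k ^ e)]
      ring]
    rw [this]
    ring

theorem isAutomaticSeq_of_coloring {τ : Type*} {k : ℕ} {f : ℕ → ℤ} {ρ : ℕ → τ} {T : τ → ℕ → τ}
    {φ : τ → ℤ} (hfin : (Set.range ρ).Finite) (hρ : ∀ n, ∀ i < k, ρ (k * n + i) = T (ρ n) i)
    (hf : ∀ n, f n = φ (ρ n)) : IsAutomaticSeq k f := by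
  have hrange : (Set.range f).Finite :=
    (hfin.image φ).subset (by rintro _ ⟨n, rfl⟩; exact ⟨ρ n, ⟨n, rfl⟩, (hf n).symm⟩)
  refine ⟨hrange, ?_⟩
  have : Finite (Set.range ρ) := hfin
  have hpi : (Set.univ.pi fun _ : Set.range ρ => Set.range f).Finite :=
    Set.Finite.pi fun _ => hrange
  refine (hpi.image fun G n => G ⟨ρ n, n, rfl⟩).subset fun h hh => ?_
  -- With multiplier 0, every kernel sequence factors through `ρ`, leaving finitely many maps from
  -- the states to the values of `f`.
  obtain ⟨c, G, hG⟩ := seqKernel_form (c := 0) (g := fun t i => φ (T t i)) hρ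
    (fun n i hi => by rw [hf, hρ n i hi]; ring) hh
  obtain ⟨i, j, -, rfl⟩ := hh
  refine ⟨fun t => c * φ t + G t, ?_, ?_⟩
  · rintro ⟨_, n, rfl⟩ -
    exact ⟨k ^ i * n + j, by simpa [hf] using hG n⟩
  · funext n
    simpa [hf] using (hG n).symm

/-- The kernel lies in the span of `f` and the finitely many indicators of states, and submodules of
finitely generated `ℤ`-modules are finitely generated. -/
theorem isRegularSeq_of_coloring {τ : Type*} {k : ℕ} {f : ℕ → ℤ} {ρ : ℕ → τ} {T : τ → ℕ → τ}
    {c : ℤ} {g : τ → ℕ → ℤ} (hfin : (Set.range ρ).Finite)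
    (hρ : ∀ n, ∀ i < k, ρ (k * n + i) = T (ρ n) i)
    (hf : ∀ n, ∀ i < k, f (k * n + i) = c * f n + g (ρ n) i) : IsRegularSeq k f := by
  classical
  let ind : τ → ℕ → ℤ := fun t n => if ρ n = t then 1 else 0
  let N := Submodule.span ℤ (insert f (ind '' Set.range ρ))
  have hN : N.FG := Submodule.fg_span ((hfin.image ind).insert f)
  have : IsNoetherian ℤ N := isNoetherian_of_fg_of_noetherian N hN
  have hle : Submodule.span ℤ (seqKernel k f) ≤ N := by
    refine Submodule.span_le.2 fun h hh => ?_
    obtain ⟨c', G, hG⟩ := seqKernel_form hρ hf hh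
    have : h = c' • f + ∑ t ∈ hfin.toFinset, G t • ind t := by
      funext n
      simp [hG, ind, Finset.sum_apply]
    rw [this]
    refine N.add_mem (N.smul_mem _ (Submodule.subset_span (Set.mem_insert _ _)))
      (N.sum_mem fun t ht => N.smul_mem _ (Submodule.subset_span (Set.mem_insert_of_mem _ ?_)))
    exact ⟨t, by simpa using ht, rfl⟩
  exact isNoetherian_submodule.1 this _ hle

/-! ### The base 4 automaton of the sequence -/

/-- The state of the base `4` automaton at `n`: the index itself if it is small, and the window at
`n - 4` otherwise. -/
def golombState (n : ℕ) : ℕ ⊕ List Letter := if n < 9 then .inl n else .inr (window (n - 4))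

/-- The transitions of the base `4` automaton. -/
def golombTransition : ℕ ⊕ List Letter → ℕ → ℕ ⊕ List Letter
  | .inl n, i => golombState (4 * n + i)
  | .inr s, i => .inr (refine s i)

theorem golombState_step (n i : ℕ) (hi : i < 4) :
    golombState (4 * n + i) = golombTransition (golombState n) i := by
  by_cases hn : n < 9
  · simp [golombState, golombTransition, hn]
  · have h : ¬ 4 * n + i < 9 := by omega
    simp only [golombState, golombTransition, hn, h, if_false]
    rw [← window_refine (n - 4) i (by omega) (by omega)]
    congr 2
    omega

theorem finite_range_golombState : (Set.range golombState).Finite := by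
  refine (((Set.finite_Iio 9).image Sum.inl).union
    ((windowPairs.finite_toSet.image Prod.fst).image Sum.inr)).subset ?_
  rintro _ ⟨n, rfl⟩
  by_cases hn : n < 9
  · exact Or.inl ⟨n, hn, by simp [golombState, hn]⟩
  · obtain ⟨q, -, -, -, hmem⟩ := exists_windowPair (n - 4) (by omega)
    exact Or.inr ⟨_, ⟨_, hmem, rfl⟩, by simp [golombState, hn]⟩

theorem isRegularSeq_golomb : IsRegularSeq 4 golomb := by
  refine isRegularSeq_of_coloring (c := 4) (g := fun t i => Sum.elim
    (fun n => golomb (4 * n + i) - 4 * golomb n)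
    (fun s => refinedSum s (16 + i) - 4 * partialSum s 4) t)
    finite_range_golombState golombState_step fun n i hi => ?_
  by_cases hn : n < 9
  · simp [golombState, hn]
  · obtain ⟨p, rfl⟩ : ∃ p, n = p + 4 := ⟨n - 4, by omega⟩
    simp only [golombState, hn, if_false, Sum.elim_inr, Nat.add_sub_cancel]
    rw [golomb_add p 4 (by omega), show 4 * (p + 4) + i = 4 * p + (16 + i) by ring,
      golomb_refine p (16 + i) (by omega) (by omega) (by omega)]
    ring

theorem isAutomaticSeq_correctors (e : Correctors → ℤ) :
    IsAutomaticSeq 4 fun n => e (correctors n) := by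
  refine isAutomaticSeq_of_coloring (φ := Sum.elim (fun n => e (correctors n))
    (fun s => e (s.getD 4 default).c)) finite_range_golombState golombState_step fun n => ?_
  by_cases hn : n < 9
  · simp [golombState, hn]
  · obtain ⟨p, rfl⟩ : ∃ p, n = p + 4 := ⟨n - 4, by omega⟩
    simp only [golombState, hn, if_false, Sum.elim_inr, Nat.add_sub_cancel]
    rw [window_getD p 4 (by omega)]
    rfl

theorem Bool.toInt_eq_zero_or_one (b : Bool) : b.toInt = 0 ∨ b.toInt = 1 := by
  cases b <;> simp

theorem almostGolomb_denest (n : ℕ) (hn : 5 ≤ n) :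
    almostGolomb (4 * n) = almostGolomb (n - 3) + almostGolomb (n - 2) + almostGolomb (n - 1) +
      almostGolomb n + 1 + (correctors n).e0.toInt ∧
    almostGolomb (4 * n + 1) = almostGolomb (n - 2) + almostGolomb (n - 1) + almostGolomb n +
      almostGolomb (n + 1) + (correctors n).e1.toInt ∧
    almostGolomb (4 * n + 2) = almostGolomb (n - 2) + almostGolomb (n - 1) + almostGolomb n +
      almostGolomb (n + 1) + (correctors n).e2.toInt ∧
    almostGolomb (4 * n + 3) = almostGolomb (n - 1) + almostGolomb n + almostGolomb (n + 1) +
      almostGolomb (n + 2) - 1 + (correctors n).e3.toInt := by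
  have hsub : ∀ j ≤ n, almostGolomb ((n : ℤ) - (j : ℕ)) = golomb (n - j) := fun j hj => by
    rw [← Nat.cast_sub hj, almostGolomb_natCast]
  have h3 := hsub 3 (by omega)
  have h2 := hsub 2 (by omega)
  have h1 := hsub 1 (by omega)
  push_cast at h3 h2 h1
  rw [h3, h2, h1]
  exact ⟨golomb_step n 0 hn (by omega), golomb_step n 1 hn (by omega),
    golomb_step n 2 hn (by omega), golomb_step n 3 hn (by omega)⟩

/-! ### The main theorem -/

theorem mainTheorem5 :
    (∃! a : ℤ → ℤ, IsAlmostGolomb 4 a) ∧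
    ∀ a : ℤ → ℤ, IsAlmostGolomb 4 a →
      (∃ ε₀ ε₁ ε₂ ε₃ : ℕ → ℤ,
        -- the correctors are binary
        (∀ n : ℕ, 5 ≤ n →
          (ε₀ n = 0 ∨ ε₀ n = 1) ∧ (ε₁ n = 0 ∨ ε₁ n = 1) ∧
          (ε₂ n = 0 ∨ ε₂ n = 1) ∧ (ε₃ n = 0 ∨ ε₃ n = 1)) ∧
        -- the denesting formulas
        (∀ n : ℕ, 5 ≤ n →
          a (4 * n) = a (n - 3) + a (n - 2) + a (n - 1) + a n + 1 + ε₀ n ∧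
          a (4 * n + 1) = a (n - 2) + a (n - 1) + a n + a (n + 1) + ε₁ n ∧
          a (4 * n + 2) = a (n - 2) + a (n - 1) + a n + a (n + 1) + ε₂ n ∧
          a (4 * n + 3) = a (n - 1) + a n + a (n + 1) + a (n + 2) - 1 + ε₃ n) ∧
        -- the values for `5 ≤ n ≤ 23`
        initialValues ε₀ = [0, 1, 1, 1, 1, 1, 1, 1, 1, 1, 1, 1, 0, 1, 0, 1, 1, 0, 1] ∧
        initialValues ε₁ = [1, 0, 0, 0, 0, 0, 0, 0, 0, 0, 0, 0, 1, 0, 1, 0, 0, 1, 0] ∧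
        initialValues ε₂ = [1, 1, 1, 1, 1, 1, 1, 1, 1, 1, 1, 0, 1, 0, 1, 1, 0, 1, 0] ∧
        initialValues ε₃ = [0, 0, 0, 0, 0, 0, 0, 0, 0, 0, 0, 1, 0, 1, 0, 0, 1, 0, 1] ∧
        -- the recurrences
        (∀ m : ℕ, 6 ≤ m →
          ε₀ (4 * m) = (1 - ε₀ m) * ε₀ (m + 1) + ε₀ m * ε₀ (m - 1) ∧
          ε₀ (4 * m + 1) = (1 - ε₀ m) * ε₀ (m - 1) + ε₀ m * ε₀ (m + 1) ∧
          ε₀ (4 * m + 2) = ε₀ m ∧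
          ε₀ (4 * m + 3) = ε₀ (m + 1) ∧
          ε₁ (4 * m) = ε₂ m * bitXor (ε₁ (m - 1)) (ε₁ (m + 1)) ∧
          ε₁ (4 * m + 1) = 1 - ε₂ m ∧
          ε₁ (4 * m + 2) = ε₁ m ∧
          ε₁ (4 * m + 3) = ε₁ (m + 1) ∧
          ε₂ (4 * m) = (1 - ε₀ (m - 1)) * ε₁ (m - 1)
            + ε₀ (m - 1) * (1 - ε₁ (m - 1)) * ε₂ m ∧
          ε₂ (4 * m + 1) = ε₂ (m - 1) ∧
          ε₂ (4 * m + 2) = ε₂ m ∧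
          ε₂ (4 * m + 3) = 1 - ε₁ m ∧
          ε₃ (4 * m) = ε₂ (m - 1) * bitXnor (ε₂ m) (ε₁ m) ∧
          ε₃ (4 * m + 1) = ε₃ (m - 1) ∧
          ε₃ (4 * m + 2) = ε₃ m ∧
          ε₃ (4 * m + 3) = (1 - ε₁ (m + 1)) * bitXnor (ε₂ m) (ε₁ m)) ∧
        -- automaticity
        IsAutomaticSeq 4 ε₀ ∧ IsAutomaticSeq 4 ε₁ ∧ IsAutomaticSeq 4 ε₂ ∧ IsAutomaticSeq 4 ε₃) ∧
      IsRegularSeq 4 (fun n : ℕ => a n) := by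
  refine ⟨⟨almostGolomb, isAlmostGolomb_almostGolomb,
    fun b hb => hb.unique isAlmostGolomb_almostGolomb⟩, fun a ha => ?_⟩
  obtain rfl := ha.unique isAlmostGolomb_almostGolomb
  refine ⟨⟨fun n => (correctors n).e0.toInt, fun n => (correctors n).e1.toInt,
    fun n => (correctors n).e2.toInt, fun n => (correctors n).e3.toInt, ?_, almostGolomb_denest,
    by decide, by decide, by decide, by decide, fun m hm => ?_,
    isAutomaticSeq_correctors fun c => c.e0.toInt, isAutomaticSeq_correctors fun c => c.e1.toInt,
    isAutomaticSeq_correctors fun c => c.e2.toInt, isAutomaticSeq_correctors fun c => c.e3.toInt⟩,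
    isRegularSeq_golomb⟩
  · exact fun n _ => ⟨Bool.toInt_eq_zero_or_one _, Bool.toInt_eq_zero_or_one _,
      Bool.toInt_eq_zero_or_one _, Bool.toInt_eq_zero_or_one _⟩
  · have h0 := correctors_step m 0 hm (by omega)
    rw [add_zero] at h0
    simp only [h0, correctors_step m 1 hm (by omega), correctors_step m 2 hm (by omega),
      correctors_step m 3 hm (by omega), correctorRule]
    generalize correctors (m - 1) = x
    generalize correctors m = y
    generalize correctors (m + 1) = z
    obtain ⟨x0, x1, x2, x3⟩ := x
    obtain ⟨y0, y1, y2, y3⟩ := y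
    obtain ⟨z0, z1, z2, z3⟩ := z
    simp only [true_and]
    -- The recurrences that merely copy a bit are already closed; the others compare a Boolean
    -- expression with a polynomial in bits.
    refine ⟨?_, ?_, ?_, ?_, ?_, ?_, ?_, ?_⟩
    · revert x0 y0 z0; decide
    · revert x0 y0 z0; decide
    · revert x1 y2 z1; decide
    · revert y2; decide
    · revert x0 x1 y2; decide
    · revert y1; decide
    · revert x2 y1 y2; decide
    · revert y1 y2 z1; decide
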